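/- All graphs are finite, simple and undirected. A proper coloring of a graph $G$ is \emph{conflict-free} if for every non-isolated vertex $v$ some color occurs exactly once in the open neighborhood $N(v)$; the least number of colors in such a coloring is denoted $\chi_{\rm pcf}(G)$. The \emph{maximum average degree} of $G$ is $\mathrm{mad}(G)=\max_{H}\frac{2|E(H)|}{|V(H)|}$, the maximum being over all nonempty subgraphs $H$ of $G$. A \emph{block} of $G$ is a maximal connected subgraph without a cut vertex (of its own). Let $\mathcal F$ be the family of connected graphs with at least two vertices in which every block is isomorphic to the $5$-cycle $C_5$. \textbf{Theorem.} Let $G$ be a connected graph with maximum average degree $\mathrm{mad}(G)=m$. Then: (i) $m<\frac{8}{3}$ implies $\chi_{\rm pcf}(G)\le 6$; (ii) $m<\frac{5}{2}$ implies $\chi_{\rm pcf}(G)\le 5$; (iii) $m<\frac{24}{11}$ implies $\chi_{\rm pcf}(G)\le 4$, unless $G\in\mathcal F$. -/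

import Mathlib

namespace PCF

universe u

/-- A proper coloring of `G` is *conflict-free* (with respect to open neighborhoods) if for every
non-isolated vertex `v` some color occurs exactly once in the neighborhood of `v`. -/
def IsConflictFree {V : Type u} {G : SimpleGraph V} {k : ℕ} (C : G.Coloring (Fin k)) : Prop :=
  ∀ v : V, (G.neighborSet v).Nonempty → ∃ c : Fin k, ∃! w : V, G.Adj v w ∧ C w = c

/-- `G` has a proper conflict-free coloring with (at most) `k` colors. -/
def Colorable {V : Type u} (G : SimpleGraph V) (k : ℕ) : Prop :=
  ∃ C : G.Coloring (Fin k), IsConflictFree C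

/-- The PCF chromatic number: the least `k` such that `G` is PCF `k`-colorable
(`⊤` if there is no such `k`, which cannot happen for a finite graph). -/
noncomputable def chromaticNumber {V : Type u} (G : SimpleGraph V) : ℕ∞ :=
  ⨅ k ∈ {k : ℕ | Colorable G k}, (k : ℕ∞)

/-- The average degree `2|E(H)| / |V(H)|` of a (finite, nonempty) subgraph `H` of `G`. -/
noncomputable def avgDegree {V : Type u} {G : SimpleGraph V} (H : G.Subgraph) : ℝ :=
  2 * (H.edgeSet.ncard : ℝ) / (H.verts.ncard : ℝ)

/-- The maximum average degree of a finite graph: the largest average degree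
of a nonempty subgraph. -/
noncomputable def mad {V : Type u} (G : SimpleGraph V) : ℝ :=
  sSup {d : ℝ | ∃ H : G.Subgraph, H.verts.Nonempty ∧ d = avgDegree H}

/-- A subgraph is *nonseparable* if it is connected and has no cut vertex: deleting any one of its
vertices does not disconnect it. (The graphs on one and on two vertices qualify.) -/
def IsNonseparable {V : Type u} {G : SimpleGraph V} (H : G.Subgraph) : Prop :=
  H.Connected ∧ ∀ v ∈ H.verts, (H.deleteVerts {v}).coe.Preconnected

/-- A *block* of `G` is a maximal nonseparable subgraph of `G`. -/
def IsBlock {V : Type u} {G : SimpleGraph V} (B : G.Subgraph) : Prop :=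
  Maximal IsNonseparable B

/-- The family of nontrivial connected graphs all of whose blocks are isomorphic to the
cycle of length five. -/
def IsC5BlockGraph {V : Type u} (G : SimpleGraph V) : Prop :=
  Nontrivial V ∧ G.Connected ∧
    ∀ B : G.Subgraph, IsBlock B → Nonempty (B.coe ≃g SimpleGraph.cycleGraph 5)

end PCF

/-!
All three parts are proved by induction on a set `A` of vertices of a fixed graph `G`, using the
sparsity of `G` only through the degree sums of its induced subgraphs. The induction deletes a set
`S` of vertices and extends a coloring of `G[A \ S]`. The basic tool is `Good.extend`: a new vertex
has to avoid, for each of its old neighbors `w`, the color of `w` and the color `f w` that is unique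
around `w`. This makes vertices of degree at most one reducible, and it bounds the number of vertices
of degree two near vertices of larger degree, in contradiction with sparsity.

With five or six colors two adjacent vertices of degree two are reducible, and so is a vertex of
degree three with three (for five colors) or two (for six colors) neighbors of degree two. Counting
the edges between vertices of degree two and the others finishes the proof (`hasGood_five`,
`hasGood_six`).

With four colors the cycle of length five is not colorable, and such components may arise when
vertices are deleted. A four-coloring of this cycle can nevertheless satisfy all vertices but one,
whose neighbors share a color `c`; as soon as such a vertex acquires a further neighbor of another
color it is satisfied. Therefore the induction (`hasGood_four`) is carried out for colorings in which
the vertices of a set `F` may see a single color, where `F` meets each component that is a cycle of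
length five; neighbors of deleted vertices may be put into `F`. Paths of four vertices of degree two
are then reducible (`HasGood.of_path`). The case in which both ends of the path are attached to the
same vertex `u` needs a coloring where `u` does not rely on the exemption; it exists because `u` does
not lie on a component of `G[A \ S]` that is a cycle of length five, two such cycles with a common
vertex being too dense. Finally, if no such path exists, at most three vertices of degree two follow
each dart leaving a vertex of larger degree (`sum_deg_two_le`), and the average degree is at least
`24/11`.

For a connected graph the remaining exception, a component that is a cycle of length five, is the
graph itself, which belongs to the excluded family (`IsCycleIn.isC5BlockGraph`).
-/

namespace PCF
universe u
open scoped Classical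

variable {V : Type u} {G : SimpleGraph V} {k : ℕ}

/-! ### Relaxed conflict-free colorings and their extension -/

/-- The vertex `v` has a color occurring exactly once among its neighbors in `A`. -/
def SatAt (G : SimpleGraph V) (A : Finset V) (φ : V → Fin k) (v : V) : Prop :=
  ∃ c, ∃! w, w ∈ A ∧ G.Adj v w ∧ φ w = c

/-- The neighbors of `v` in `A` all have the same color (there may be none). -/
def MonoAt (G : SimpleGraph V) (A : Finset V) (φ : V → Fin k) (v : V) : Prop :=
  ∃ c, ∀ w ∈ A, G.Adj v w → φ w = c

/-- The condition imposed on a vertex `v` of `A` by a relaxed conflict-free coloring of `G[A]`: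
members of the set `F` of exempt vertices may also see a single color, and nothing is required of a
vertex without neighbors in `A`. -/
def GoodAt (G : SimpleGraph V) (A : Finset V) (F : Set V) (φ : V → Fin k) (v : V) : Prop :=
  SatAt G A φ v ∨ MonoAt G A φ v ∧ (v ∈ F ∨ ∀ w ∈ A, ¬ G.Adj v w)

/-- `φ` restricts to a proper coloring of `G[A]` that is conflict-free, except that the neighborhood
of a vertex in `F` may be monochromatic instead. Values of `φ` outside `A` are irrelevant. -/
structure Good (G : SimpleGraph V) (A : Finset V) (F : Set V) (φ : V → Fin k) : Prop where
  proper : ∀ v ∈ A, ∀ w ∈ A, G.Adj v w → φ v ≠ φ w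
  good : ∀ v ∈ A, GoodAt G A F φ v

/-- Some coloring with `k` colors is `Good`. -/
def HasGood (k : ℕ) (G : SimpleGraph V) (A : Finset V) (F : Set V) : Prop :=
  ∃ φ : V → Fin k, Good G A F φ

theorem SatAt.of_pair {A : Finset V} {φ : V → Fin k} {v a b : V}
    (ha : a ∈ A) (hva : G.Adj v a) (h : ∀ z ∈ A, G.Adj v z → z = a ∨ z = b) (hab : φ a ≠ φ b) :
    SatAt G A φ v := by
  refine ⟨φ a, a, ⟨ha, hva, rfl⟩, ?_⟩
  rintro z ⟨hz, hvz, he⟩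
  rcases h z hz hvz with rfl | rfl
  · rfl
  · exact absurd he.symm hab

theorem SatAt.of_triple {A : Finset V} {φ : V → Fin k} {v a b c : V}
    (ha : a ∈ A) (hva : G.Adj v a) (hb : b ∈ A) (hvb : G.Adj v b)
    (h : ∀ z ∈ A, G.Adj v z → z = a ∨ z = b ∨ z = c) (hab : φ a ≠ φ b) :
    SatAt G A φ v := by
  by_cases hac : φ c = φ a
  · refine ⟨φ b, b, ⟨hb, hvb, rfl⟩, ?_⟩
    rintro z ⟨hz, hvz, he⟩
    rcases h z hz hvz with rfl | rfl | rfl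
    · exact absurd he hab
    · rfl
    · exact absurd (hac.symm.trans he) hab
  · refine ⟨φ a, a, ⟨ha, hva, rfl⟩, ?_⟩
    rintro z ⟨hz, hvz, he⟩
    rcases h z hz hvz with rfl | rfl | rfl
    · rfl
    · exact absurd he.symm hab
    · exact absurd he hac

theorem SatAt.of_injOn {A : Finset V} {φ : V → Fin k} {v : V} (he : ∃ s ∈ A, G.Adj v s)
    (h : ∀ s ∈ A, ∀ t ∈ A, G.Adj v s → G.Adj v t → φ s = φ t → s = t) : SatAt G A φ v := by
  obtain ⟨s, hs, hvs⟩ := he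
  exact ⟨φ s, s, ⟨hs, hvs, rfl⟩, fun t ⟨ht, hvt, e⟩ => h t ht s hs hvt hvs e⟩

/-- A relaxed coloring of `G[B]` extends to `G[B ∪ S]` as soon as the new vertices avoid, besides
the colors of their neighbors, one further color `f w` for each neighbor `w` in `B`: the color that
is unique around `w`, or the only color around `w`. In the second case the new neighbors of `w` must
in addition provide a unique color. -/
theorem Good.extend {A B S : Finset V} {F F' : Set V} {φ : V → Fin k} (hφ : Good G B F' φ)
    (hA : A = B ∪ S) (hF : ∀ v ∈ F', v ∈ F ∨ ∃ s ∈ S, G.Adj v s) :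
    ∃ f : V → Fin k, ∀ ψ : V → Fin k, (∀ w ∈ B, ψ w = φ w) →
      (∀ s ∈ S, ∀ t ∈ S, G.Adj s t → ψ s ≠ ψ t) →
      (∀ s ∈ S, ∀ w ∈ B, G.Adj s w → ψ s ≠ φ w ∧ ψ s ≠ f w) →
      (∀ s ∈ S, GoodAt G A F ψ s) →
      (∀ w ∈ B, (w ∈ F' ∨ ∀ z ∈ B, ¬ G.Adj w z) → (∃ s ∈ S, G.Adj w s) → SatAt G S ψ w) →
      Good G A F ψ := by
  -- `c` is the unique color around `w` or, failing that, the only one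
  have key : ∀ w, ∃ c, w ∈ B → (∃! z, z ∈ B ∧ G.Adj w z ∧ φ z = c) ∨
      (∀ z ∈ B, G.Adj w z → φ z = c) ∧ (w ∈ F' ∨ ∀ z ∈ B, ¬ G.Adj w z) := by
    intro w
    by_cases hw : w ∈ B
    · rcases hφ.good w hw with ⟨c, hc⟩ | ⟨⟨c, hc⟩, h⟩
      · exact ⟨c, fun _ => Or.inl hc⟩
      · exact ⟨c, fun _ => Or.inr ⟨hc, h⟩⟩
    · exact ⟨φ w, fun h => absurd h hw⟩
  choose f hf using key
  refine ⟨f, fun ψ hψ hS hSB hgS hsat => ?_⟩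
  subst hA
  constructor
  · intro v hv w hw hvw
    rcases Finset.mem_union.1 hv with hv | hv <;> rcases Finset.mem_union.1 hw with hw | hw
    · rw [hψ v hv, hψ w hw]; exact hφ.proper v hv w hw hvw
    · rw [hψ v hv]; exact (hSB w hw v hv hvw.symm).1.symm
    · rw [hψ w hw]; exact (hSB v hv w hw hvw).1
    · exact hS v hv w hw hvw
  · intro v hv
    rcases Finset.mem_union.1 hv with hv | hv
    swap
    · exact hgS v hv
    rcases hf v hv with ⟨z, ⟨hzB, hvz, hzc⟩, huniq⟩ | ⟨hmono, hweak⟩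
    · left
      refine ⟨f v, z, ⟨Finset.mem_union_left _ hzB, hvz, (hψ z hzB).trans hzc⟩, ?_⟩
      rintro y ⟨hy, hvy, hyc⟩
      rcases Finset.mem_union.1 hy with hy | hy
      · exact huniq y ⟨hy, hvy, (hψ y hy).symm.trans hyc⟩
      · exact absurd hyc (hSB y hy v hv hvy.symm).2
    · by_cases hex : ∃ s ∈ S, G.Adj v s
      · left
        obtain ⟨c, z, ⟨hzS, hvz, hzc⟩, huniq⟩ := hsat v hv hweak hex
        refine ⟨c, z, ⟨Finset.mem_union_right _ hzS, hvz, hzc⟩, ?_⟩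
        rintro y ⟨hy, hvy, hyc⟩
        rcases Finset.mem_union.1 hy with hy | hy
        · have h1 := hmono y hy hvy
          have h2 := (hSB z hzS v hv hvz.symm).2
          rw [hzc, ← hyc, hψ y hy] at h2
          exact absurd h1 h2
        · exact huniq y ⟨hy, hvy, hyc⟩
      · right
        push Not at hex
        refine ⟨⟨f v, fun w hw hvw => ?_⟩, ?_⟩
        · rcases Finset.mem_union.1 hw with hw | hw
          · rw [hψ w hw]; exact hmono w hw hvw
          · exact absurd hvw (hex w hw)
        · rcases hweak with h | h
          · rcases hF v h with h | ⟨s, hs, hvs⟩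
            · exact Or.inl h
            · exact absurd hvs (hex s hs)
          · right
            intro w hw
            rcases Finset.mem_union.1 hw with hw | hw
            · exact h w hw
            · exact hex w hw

theorem exists_avoiding (L : List (Fin k)) (h : L.length < k) : ∃ c : Fin k, c ∉ L := by
  by_contra! hc
  have h1 : (Finset.univ : Finset (Fin k)) ⊆ L.toFinset := fun c _ => List.mem_toFinset.2 (hc c)
  have h2 := (Finset.card_le_card h1).trans L.toFinset_card_le
  simp at h2
  omega

/-- The number of neighbors of `v` in `A`. -/
noncomputable def deg (G : SimpleGraph V) (A : Finset V) (v : V) : ℕ :=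
  (A.filter (G.Adj v)).card

theorem exists_other_nbr {A : Finset V} {v a : V} (hv : deg G A v = 2) (ha : a ∈ A)
    (hva : G.Adj v a) :
    ∃ b ∈ A, b ≠ a ∧ G.Adj v b ∧ ∀ z ∈ A, G.Adj v z → z = a ∨ z = b := by
  have ham : a ∈ A.filter (G.Adj v) := Finset.mem_filter.2 ⟨ha, hva⟩
  have hc : ((A.filter (G.Adj v)).erase a).card = 1 := by
    rw [Finset.card_erase_of_mem ham]; unfold deg at hv; omega
  obtain ⟨b, hb⟩ := Finset.card_eq_one.1 hc
  have hbm : b ∈ (A.filter (G.Adj v)).erase a := by rw [hb]; simp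
  simp only [Finset.mem_erase, Finset.mem_filter] at hbm
  refine ⟨b, hbm.2.1, hbm.1, hbm.2.2, fun z hz hvz => ?_⟩
  by_cases hza : z = a
  · exact Or.inl hza
  · right
    have : z ∈ (A.filter (G.Adj v)).erase a := by simp [hza, hz, hvz]
    rw [hb] at this
    simpa using this

theorem HasGood.empty (hk : 0 < k) (F : Set V) : HasGood k G ∅ F :=
  ⟨fun _ => ⟨0, hk⟩, ⟨by simp, by simp⟩⟩

theorem HasGood.mono {A : Finset V} {F F' : Set V} (h : HasGood k G A F) (hF : F ⊆ F') :
    HasGood k G A F' := by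
  obtain ⟨φ, h⟩ := h
  refine ⟨φ, h.proper, fun v hv => ?_⟩
  rcases h.good v hv with h | ⟨h, h' | h'⟩
  · exact Or.inl h
  · exact Or.inr ⟨h, Or.inl (hF h')⟩
  · exact Or.inr ⟨h, Or.inr h'⟩

/-- The vertices that have a neighbor in `S`, whether or not they belong to `S`. -/
def nbrs (G : SimpleGraph V) (S : Finset V) : Set V := {v | ∃ s ∈ S, G.Adj v s}

/-- Vertices of degree at most one can be colored last: at most two colors are forbidden. -/
theorem HasGood.of_deg_le_one {A : Finset V} {F : Set V} {v : V} (hk : 3 ≤ k) (hv : v ∈ A)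
    (hd : deg G A v ≤ 1) (h : HasGood k G (A \ {v}) (F ∪ nbrs G {v})) : HasGood k G A F := by
  obtain ⟨φ, hφ⟩ := h
  obtain ⟨f, hf⟩ := hφ.extend (A := A) (S := {v}) (F := F)
    (by simp [Finset.union_eq_left.2 (Finset.singleton_subset_iff.2 hv)]) (fun w hw => hw)
  have hone : ∀ a ∈ A, ∀ b ∈ A, G.Adj v a → G.Adj v b → a = b := by
    intro a ha b hb h1 h2
    exact Finset.card_le_one.1 hd a (by simp [ha, h1]) b (by simp [hb, h2])
  obtain ⟨c, hc⟩ : ∃ c : Fin k, ∀ w ∈ A, G.Adj v w → c ≠ φ w ∧ c ≠ f w := by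
    by_cases hex : ∃ w ∈ A, G.Adj v w
    · obtain ⟨w, hw, hvw⟩ := hex
      obtain ⟨c, hc⟩ := exists_avoiding [φ w, f w] (by simp; omega)
      refine ⟨c, fun z hz hvz => ?_⟩
      rw [hone z hz w hw hvz hvw]
      simpa using hc
    · push Not at hex
      exact ⟨⟨0, by omega⟩, fun w hw hvw => absurd hvw (hex w hw)⟩
  refine ⟨Function.update φ v c, hf _ ?_ ?_ ?_ ?_ ?_⟩
  · intro w hw
    have : w ≠ v := by simp at hw; exact hw.2
    simp [this]
  · intro s hs t ht hst
    simp only [Finset.mem_singleton] at hs ht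
    subst hs; subst ht
    exact absurd hst (G.irrefl)
  · intro s hs w hw hsw
    simp only [Finset.mem_singleton] at hs
    subst hs
    simpa using hc w (Finset.mem_sdiff.1 hw).1 hsw
  · intro s hs
    simp only [Finset.mem_singleton] at hs
    subst hs
    by_cases hex : ∃ w ∈ A, G.Adj s w
    · exact Or.inl (SatAt.of_injOn hex fun a ha b hb h1 h2 _ => hone a ha b hb h1 h2)
    · push Not at hex
      exact Or.inr ⟨⟨c, fun w hw h => absurd h (hex w hw)⟩, Or.inr hex⟩
  · intro w _ _ hex
    refine SatAt.of_injOn hex fun a ha b hb _ _ _ => ?_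
    rw [Finset.mem_singleton.1 ha, Finset.mem_singleton.1 hb]

/-! ### Reducible configurations for five and six colors -/

/-- With five colors, two adjacent vertices of degree two are reducible: apart from the constraints of
`Good.extend`, each must differ from the outer neighbor of the other, which leaves a color for the
first one and then for the second one. -/
theorem HasGood.of_adj_deg_two {A : Finset V} {x y : V} (hk : 5 ≤ k) (hx : x ∈ A) (hy : y ∈ A)
    (hxy : G.Adj x y) (hdx : deg G A x = 2) (hdy : deg G A y = 2)
    (h : HasGood k G (A \ {x, y}) ∅) : HasGood k G A ∅ := by
  obtain ⟨φ, hφ⟩ := h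
  obtain ⟨u, -, huy, hxu, hxn⟩ := exists_other_nbr hdx hy hxy
  obtain ⟨w, -, hwx, hyw, hyn⟩ := exists_other_nbr hdy hx hxy.symm
  have hsub : ({x, y} : Finset V) ⊆ A := by
    intro z hz; simp only [Finset.mem_insert, Finset.mem_singleton] at hz
    rcases hz with rfl | rfl <;> assumption
  obtain ⟨f, hf⟩ := hφ.extend (A := A) (S := {x, y}) (F := ∅)
    (Finset.sdiff_union_of_subset hsub).symm (fun w hw => Or.inl hw)
  have hne := hxy.ne
  obtain ⟨c, hc⟩ := exists_avoiding (k := k) [φ u, f u, φ w] (by simp; omega)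
  obtain ⟨d, hd⟩ := exists_avoiding (k := k) [φ w, f w, φ u, c] (by simp; omega)
  simp only [List.mem_cons, List.not_mem_nil, or_false, not_or] at hc hd
  obtain ⟨ψ, hψ⟩ : ∃ ψ, ψ = Function.update (Function.update φ x c) y d := ⟨_, rfl⟩
  have hψx : ψ x = c := by simp [hψ, hne]
  have hψy : ψ y = d := by simp [hψ]
  have hψo : ∀ z, z ≠ x → z ≠ y → ψ z = φ z := fun z h1 h2 => by simp [hψ, h1, h2]
  have hB : ∀ z ∈ A \ {x, y}, z ≠ x ∧ z ≠ y := fun z hz => by simp at hz; exact hz.2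
  have hux := hxu.ne'
  have hwy := hyw.ne'
  refine ⟨ψ, hf ψ (fun z hz => hψo z (hB z hz).1 (hB z hz).2) ?_ ?_ ?_ ?_⟩
  · intro s hs t ht hst
    simp only [Finset.mem_insert, Finset.mem_singleton] at hs ht
    rcases hs with rfl | rfl <;> rcases ht with rfl | rfl
    · exact absurd hst G.irrefl
    · rw [hψx, hψy]; exact fun h => hd.2.2.2 h.symm
    · rw [hψx, hψy]; exact hd.2.2.2
    · exact absurd hst G.irrefl
  · intro s hs z hz hsz
    have hz' := hB z hz
    have hzA := (Finset.mem_sdiff.1 hz).1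
    simp only [Finset.mem_insert, Finset.mem_singleton] at hs
    rcases hs with rfl | rfl
    · rcases hxn z hzA hsz with rfl | rfl
      · exact absurd rfl hz'.2
      · rw [hψx]; exact ⟨hc.1, hc.2.1⟩
    · rcases hyn z hzA hsz with rfl | rfl
      · exact absurd rfl hz'.1
      · rw [hψy]; exact ⟨hd.1, hd.2.1⟩
  · intro s hs
    simp only [Finset.mem_insert, Finset.mem_singleton] at hs
    left
    rcases hs with rfl | rfl
    · refine SatAt.of_pair hy hxy hxn ?_
      rw [hψy, hψo u hux huy]; exact hd.2.2.1
    · refine SatAt.of_pair hx hxy.symm hyn ?_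
      rw [hψx, hψo w hwx hwy]; exact hc.2.2
  · intro z _ _ hex
    refine SatAt.of_injOn hex fun a ha b hb _ _ he => ?_
    have hcd : c ≠ d := fun h => hd.2.2.2 h.symm
    simp only [Finset.mem_insert, Finset.mem_singleton] at ha hb
    rcases ha with rfl | rfl <;> rcases hb with rfl | rfl
    · rfl
    · rw [hψx, hψy] at he; exact absurd he hcd
    · rw [hψx, hψy] at he; exact absurd he.symm hcd
    · rfl

/-- With six colors, a vertex of degree three with two neighbors `x₁, x₂` of degree two is
reducible: the three vertices can be colored with three distinct colors. -/
theorem HasGood.of_deg_three_of_two {A : Finset V} {v x₁ x₂ w u₁ u₂ : V} (hk : 6 ≤ k)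
    (hv : v ∈ A) (hx₁ : x₁ ∈ A) (hx₂ : x₂ ∈ A) (hx : x₁ ≠ x₂)
    (hvx₁ : G.Adj v x₁) (hvx₂ : G.Adj v x₂)
    (hvn : ∀ z ∈ A, G.Adj v z → z = x₁ ∨ z = x₂ ∨ z = w)
    (hn₁ : ∀ z ∈ A, G.Adj x₁ z → z = v ∨ z = u₁) (hn₂ : ∀ z ∈ A, G.Adj x₂ z → z = v ∨ z = u₂)
    (hu₁v : u₁ ≠ v) (hu₂v : u₂ ≠ v) (hxu₁ : G.Adj x₁ u₁) (hxu₂ : G.Adj x₂ u₂)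
    (hxx : ¬ G.Adj x₁ x₂)
    (h : HasGood k G (A \ {v, x₁, x₂}) ∅) : HasGood k G A ∅ := by
  obtain ⟨φ, hφ⟩ := h
  have hsub : ({v, x₁, x₂} : Finset V) ⊆ A := by
    intro z hz; simp only [Finset.mem_insert, Finset.mem_singleton] at hz
    rcases hz with rfl | rfl | rfl <;> assumption
  obtain ⟨f, hf⟩ := hφ.extend (A := A) (S := {v, x₁, x₂}) (F := ∅)
    (Finset.sdiff_union_of_subset hsub).symm (fun w hw => Or.inl hw)
  have hne₁ := hvx₁.ne
  have hne₂ := hvx₂.ne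
  obtain ⟨c, hc⟩ := exists_avoiding (k := k) [φ u₁, φ u₂, φ w, f w] (by simp; omega)
  obtain ⟨c₁, hc₁⟩ := exists_avoiding (k := k) [c, φ u₁, f u₁] (by simp; omega)
  obtain ⟨c₂, hc₂⟩ := exists_avoiding (k := k) [c, φ u₂, f u₂, c₁] (by simp; omega)
  simp only [List.mem_cons, List.not_mem_nil, or_false, not_or] at hc hc₁ hc₂
  obtain ⟨ψ, hψ⟩ : ∃ ψ, ψ = Function.update (Function.update (Function.update φ v c) x₁ c₁) x₂ c₂ :=
    ⟨_, rfl⟩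
  have hψv : ψ v = c := by simp [hψ, hne₁, hne₂]
  have hψ₁ : ψ x₁ = c₁ := by simp [hψ, hx]
  have hψ₂ : ψ x₂ = c₂ := by simp [hψ]
  have hψo : ∀ z, z ≠ v → z ≠ x₁ → z ≠ x₂ → ψ z = φ z := fun z h1 h2 h3 => by
    simp [hψ, h1, h2, h3]
  have hB : ∀ z ∈ A \ {v, x₁, x₂}, z ≠ v ∧ z ≠ x₁ ∧ z ≠ x₂ := fun z hz => by
    simp at hz; exact hz.2
  have hinj : ∀ a ∈ ({v, x₁, x₂} : Finset V), ∀ b ∈ ({v, x₁, x₂} : Finset V),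
      ψ a = ψ b → a = b := by
    intro a ha b hb he
    simp only [Finset.mem_insert, Finset.mem_singleton] at ha hb
    rcases ha with rfl | rfl | rfl <;> rcases hb with rfl | rfl | rfl <;> first | rfl | skip
    all_goals
      exfalso
      simp only [hψv, hψ₁, hψ₂] at he
      simp_all
  refine ⟨ψ, hf ψ (fun z hz => hψo z (hB z hz).1 (hB z hz).2.1 (hB z hz).2.2) ?_ ?_ ?_ ?_⟩
  · intro s hs t ht hst he
    exact hst.ne (hinj s hs t ht he)
  · intro s hs z hz hsz
    have hz' := hB z hz
    have hzA := (Finset.mem_sdiff.1 hz).1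
    simp only [Finset.mem_insert, Finset.mem_singleton] at hs
    rcases hs with rfl | rfl | rfl
    · rcases hvn z hzA hsz with rfl | rfl | rfl
      · exact absurd rfl hz'.2.1
      · exact absurd rfl hz'.2.2
      · rw [hψv]; exact hc.2.2
    · rcases hn₁ z hzA hsz with rfl | rfl
      · exact absurd rfl hz'.1
      · rw [hψ₁]; exact hc₁.2
    · rcases hn₂ z hzA hsz with rfl | rfl
      · exact absurd rfl hz'.1
      · rw [hψ₂]; exact ⟨hc₂.2.1, hc₂.2.2.1⟩
  · intro s hs
    simp only [Finset.mem_insert, Finset.mem_singleton] at hs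
    left
    rcases hs with rfl | rfl | rfl
    · refine SatAt.of_triple hx₁ hvx₁ hx₂ hvx₂ hvn ?_
      rw [hψ₁, hψ₂]; exact fun h => hc₂.2.2.2 h.symm
    · refine SatAt.of_pair hv hvx₁.symm hn₁ ?_
      have h2 : u₁ ≠ x₂ := fun h => hxx (h ▸ hxu₁)
      rw [hψv, hψo u₁ hu₁v hxu₁.ne' h2]; exact hc.1
    · refine SatAt.of_pair hv hvx₂.symm hn₂ ?_
      have h2 : u₂ ≠ x₁ := fun h => hxx (h ▸ hxu₂).symm
      rw [hψv, hψo u₂ hu₂v h2 hxu₂.ne']; exact hc.2.1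
  · intro z _ _ hex
    exact SatAt.of_injOn hex fun a ha b hb _ _ he => hinj a ha b hb he

/-- With five colors, a vertex `v` of degree three all of whose neighbors have degree two is
reducible. A vertex all of whose remaining neighbors are erased is adjacent to all three neighbors
of `v`, as it has degree at least three. -/
theorem HasGood.of_deg_three_of_three {A : Finset V} {v : V} {x u : Fin 3 → V} (hk : 5 ≤ k)
    (hv : v ∈ A) (hxA : ∀ i, x i ∈ A) (hx : Function.Injective x)
    (hvx : ∀ i, G.Adj v (x i)) (hvn : ∀ z ∈ A, G.Adj v z → ∃ i, z = x i)
    (hxn : ∀ i, ∀ z ∈ A, G.Adj (x i) z → z = v ∨ z = u i) (huv : ∀ i, u i ≠ v)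
    (hxu : ∀ i, G.Adj (x i) (u i)) (hxx : ∀ i j, ¬ G.Adj (x i) (x j))
    (hdeg : ∀ i, 3 ≤ deg G A (u i))
    (h : HasGood k G (A \ insert v (Finset.univ.image x)) ∅) : HasGood k G A ∅ := by
  obtain ⟨φ, hφ⟩ := h
  have hsub : insert v (Finset.univ.image x) ⊆ A := by
    intro z hz
    simp only [Finset.mem_insert, Finset.mem_image, Finset.mem_univ, true_and] at hz
    rcases hz with rfl | ⟨i, rfl⟩
    · exact hv
    · exact hxA i
  obtain ⟨f, hf⟩ := hφ.extend (A := A) (S := insert v (Finset.univ.image x)) (F := ∅)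
    (Finset.sdiff_union_of_subset hsub).symm (fun w hw => Or.inl hw)
  obtain ⟨c, hc⟩ := exists_avoiding (k := k) [φ (u 0), φ (u 1), φ (u 2)] (by simp; omega)
  obtain ⟨c₀, hc₀⟩ := exists_avoiding (k := k) [c, φ (u 0), f (u 0)] (by simp; omega)
  obtain ⟨c₁, hc₁⟩ := exists_avoiding (k := k) [c, φ (u 1), f (u 1), c₀] (by simp; omega)
  obtain ⟨c₂, hc₂⟩ := exists_avoiding (k := k) [c, φ (u 2), f (u 2)] (by simp; omega)
  simp only [List.mem_cons, List.not_mem_nil, or_false, not_or] at hc hc₀ hc₁ hc₂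
  -- it suffices that `x 0` and `x 1` get distinct colors: then some color is unique on the `x i`
  obtain ⟨γ, hγ⟩ : ∃ γ : Fin 3 → Fin k, γ = ![c₀, c₁, c₂] := ⟨_, rfl⟩
  have hγ01 : γ 0 ≠ γ 1 := by simp [hγ]; exact fun h => hc₁.2.2.2 h.symm
  have hγi : ∀ i, γ i ≠ c ∧ γ i ≠ φ (u i) ∧ γ i ≠ f (u i) := by
    intro i; fin_cases i
    · simpa [hγ] using hc₀
    · simp [hγ]; exact ⟨hc₁.1, hc₁.2.1, hc₁.2.2.1⟩
    · simpa [hγ] using hc₂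
  have hci : ∀ i, c ≠ φ (u i) := by
    intro i; fin_cases i
    · exact hc.1
    · exact hc.2.1
    · exact hc.2.2
  obtain ⟨ψ, hψ⟩ : ∃ ψ : V → Fin k, ψ = Function.extend x γ (Function.update φ v c) := ⟨_, rfl⟩
  have hvne : ∀ i, x i ≠ v := fun i => (hvx i).ne'
  have hψx : ∀ i, ψ (x i) = γ i := fun i => by rw [hψ, hx.extend_apply]
  have hψv : ψ v = c := by
    rw [hψ, Function.extend_apply' _ _ _ (by rintro ⟨i, hi⟩; exact hvne i hi)]; simp
  have hψo : ∀ z, z ≠ v → (∀ i, z ≠ x i) → ψ z = φ z := fun z h1 h2 => by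
    rw [hψ, Function.extend_apply' _ _ _ (by rintro ⟨i, hi⟩; exact h2 i hi.symm)]; simp [h1]
  have hS : ∀ z, z ∈ insert v (Finset.univ.image x) ↔ z = v ∨ ∃ i, z = x i := by
    intro z; simp [eq_comm]
  have hB : ∀ z ∈ A \ insert v (Finset.univ.image x), z ≠ v ∧ ∀ i, z ≠ x i := fun z hz => by
    rw [Finset.mem_sdiff, hS] at hz; push Not at hz; exact hz.2
  have hux : ∀ i j, u i ≠ x j := fun i j h => hxx i j (h ▸ hxu i)
  refine ⟨ψ, hf ψ (fun z hz => hψo z (hB z hz).1 (hB z hz).2) ?_ ?_ ?_ ?_⟩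
  · intro s hs t ht hst
    rw [hS] at hs ht
    rcases hs with rfl | ⟨i, rfl⟩ <;> rcases ht with rfl | ⟨j, rfl⟩
    · exact absurd hst G.irrefl
    · rw [hψv, hψx]; exact (hγi j).1.symm
    · rw [hψv, hψx]; exact (hγi i).1
    · exact absurd hst (hxx i j)
  · intro s hs z hz hsz
    have hz' := hB z hz
    have hzA := (Finset.mem_sdiff.1 hz).1
    rw [hS] at hs
    rcases hs with rfl | ⟨i, rfl⟩
    · obtain ⟨i, rfl⟩ := hvn z hzA hsz
      exact absurd rfl (hz'.2 i)
    · rcases hxn i z hzA hsz with rfl | rfl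
      · exact absurd rfl hz'.1
      · rw [hψx]; exact (hγi i).2
  · intro s hs
    rw [hS] at hs
    left
    rcases hs with rfl | ⟨i, rfl⟩
    · refine SatAt.of_triple (a := x 0) (b := x 1) (c := x 2) (hxA 0) (hvx 0) (hxA 1) (hvx 1) ?_ ?_
      · intro z hz hsz
        obtain ⟨i, rfl⟩ := hvn z hz hsz
        fin_cases i <;> simp
      · rw [hψx, hψx]; exact hγ01
    · refine SatAt.of_pair hv (hvx i).symm (hxn i) ?_
      rw [hψv, hψo _ (huv i) (hux i)]; exact hci i
  · intro z hz hiso hex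
    have hiso : ∀ y ∈ A \ insert v (Finset.univ.image x), ¬ G.Adj z y := by simpa using hiso
    have hzA := (Finset.mem_sdiff.1 hz).1
    have hzv : ¬ G.Adj z v := fun hadj => by
      obtain ⟨i, hi⟩ := hvn z hzA hadj.symm
      exact (hB z hz).2 i hi
    obtain ⟨s, hs, hzs⟩ := hex
    obtain ⟨i, rfl⟩ : ∃ i, z = u i := by
      rcases (hS s).1 hs with rfl | ⟨i, rfl⟩
      · exact absurd hzs hzv
      · rcases hxn i z hzA hzs.symm with rfl | h
        · exact absurd rfl (hB z hz).1
        · exact ⟨i, h⟩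
    have hsubx : A.filter (G.Adj (u i)) ⊆ Finset.univ.image x := by
      intro y hy
      obtain ⟨hyA, hy⟩ := Finset.mem_filter.1 hy
      by_contra hn
      refine hiso y (Finset.mem_sdiff.2 ⟨hyA, ?_⟩) hy
      rw [Finset.mem_insert, not_or]
      exact ⟨fun h => hzv (h ▸ hy), hn⟩
    have heq : A.filter (G.Adj (u i)) = Finset.univ.image x := by
      refine Finset.eq_of_subset_of_card_le hsubx ?_
      rw [Finset.card_image_of_injective _ hx]
      simpa [deg] using hdeg i
    have hall : ∀ j, G.Adj (u i) (x j) := fun j =>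
      (Finset.mem_filter.1 (heq ▸ Finset.mem_image_of_mem x (Finset.mem_univ j))).2
    have hxS : ∀ j, x j ∈ insert v (Finset.univ.image x) := fun j => (hS _).2 (Or.inr ⟨j, rfl⟩)
    refine SatAt.of_triple (a := x 0) (b := x 1) (c := x 2) (hxS 0) (hall 0) (hxS 1) (hall 1) ?_ ?_
    · intro y hy huy
      rcases (hS y).1 hy with rfl | ⟨j, rfl⟩
      · exact absurd huy hzv
      · fin_cases j <;> simp
    · rw [hψx, hψx]; exact hγ01

/-! ### Sparsity thresholds for five and six colors -/

/-- If the vertices of degree two are independent, all edges at them lead to other vertices. -/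
theorem two_mul_card_deg_two_le {A : Finset V}
    (hind : ∀ x ∈ A, ∀ y ∈ A, deg G A x = 2 → deg G A y = 2 → ¬ G.Adj x y) :
    2 * (A.filter (deg G A · = 2)).card ≤
      ∑ v ∈ A.filter (¬ deg G A · = 2), (A.filter fun x => G.Adj v x ∧ deg G A x = 2).card := by
  have h := Finset.sum_card_bipartiteAbove_eq_sum_card_bipartiteBelow (r := G.Adj)
    (s := A.filter (deg G A · = 2)) (t := A.filter (¬ deg G A · = 2))
  have h1 : ∀ a ∈ A.filter (deg G A · = 2),
      ((A.filter (¬ deg G A · = 2)).bipartiteAbove G.Adj a).card = 2 := by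
    intro a ha
    obtain ⟨haA, ha2⟩ := Finset.mem_filter.1 ha
    refine (congrArg Finset.card (?_ : _ = A.filter (G.Adj a))).trans ha2
    ext z
    simp only [Finset.mem_bipartiteAbove, Finset.mem_filter]
    exact ⟨fun h => ⟨h.1.1, h.2⟩, fun h => ⟨⟨h.1, fun hz => hind a haA z h.1 ha2 hz h.2⟩, h.2⟩⟩
  rw [Finset.sum_congr rfl h1, Finset.sum_const, smul_eq_mul, mul_comm] at h
  rw [h]
  refine Finset.sum_le_sum fun b _ => Finset.card_le_card fun z hz => ?_
  simp only [Finset.mem_bipartiteBelow, Finset.mem_filter] at hz ⊢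
  exact ⟨hz.1.1, hz.2.symm, hz.1.2⟩

theorem two_le_deg_of_minimal {A : Finset V} (hk : 3 ≤ k)
    (hmin : ∀ B ⊂ A, HasGood k G B ∅) (hA : ¬ HasGood k G A ∅) : ∀ v ∈ A, 2 ≤ deg G A v := by
  intro v hv
  by_contra hlt
  refine hA (HasGood.of_deg_le_one hk hv (by omega) ((hmin _ ?_).mono (Set.empty_subset _)))
  exact Finset.sdiff_ssubset (by simpa using hv) (by simp)

theorem not_adj_deg_two_of_minimal {A : Finset V} (hk : 5 ≤ k)
    (hmin : ∀ B ⊂ A, HasGood k G B ∅) (hA : ¬ HasGood k G A ∅) :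
    ∀ x ∈ A, ∀ y ∈ A, deg G A x = 2 → deg G A y = 2 → ¬ G.Adj x y := by
  intro x hx y hy hdx hdy hxy
  refine hA (HasGood.of_adj_deg_two hk hx hy hxy hdx hdy (hmin _ ?_))
  refine Finset.sdiff_ssubset ?_ (by simp)
  intro z hz; simp only [Finset.mem_insert, Finset.mem_singleton] at hz
  rcases hz with rfl | rfl <;> assumption

theorem sum_deg_eq {A : Finset V} :
    ∑ v ∈ A, deg G A v = 2 * (A.filter (deg G A · = 2)).card +
      ∑ v ∈ A.filter (¬ deg G A · = 2), deg G A v := by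
  rw [← Finset.sum_filter_add_sum_filter_not A (deg G A · = 2),
    Finset.sum_congr rfl (g := fun _ => 2) (fun v hv => (Finset.mem_filter.1 hv).2)]
  simp [mul_comm]

/-- Graphs of maximum average degree less than `8/3`: in a minimal counterexample, vertices of
degree two are independent, and a vertex of degree three has at most one of them as a neighbor. So
if each vertex of degree two receives `1/3` from both neighbors, all charges are at least `8/3`. -/
theorem hasGood_six (hs : ∀ X : Finset V, X.Nonempty → 3 * ∑ v ∈ X, deg G X v < 8 * X.card)
    (A : Finset V) : HasGood 6 G A ∅ := by
  induction A using Finset.strongInduction with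
  | H A hmin =>
  by_contra hA
  have hne : A.Nonempty := by
    rw [Finset.nonempty_iff_ne_empty]; rintro rfl; exact hA (HasGood.empty (by omega) _)
  have hdeg := two_le_deg_of_minimal (by omega) hmin hA
  have hind := not_adj_deg_two_of_minimal (by omega) hmin hA
  have hv : ∀ v ∈ A.filter (¬ deg G A · = 2),
      (A.filter fun x => G.Adj v x ∧ deg G A x = 2).card + 8 ≤ 3 * deg G A v := by
    intro v hv
    obtain ⟨hvA, hv2⟩ := Finset.mem_filter.1 hv
    have h2 := hdeg v hvA
    have hsub : (A.filter fun x => G.Adj v x ∧ deg G A x = 2) ⊆ A.filter (G.Adj v) := by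
      intro x; simp only [Finset.mem_filter]; exact fun h => ⟨h.1, h.2.1⟩
    have hle : (A.filter fun x => G.Adj v x ∧ deg G A x = 2).card ≤ deg G A v :=
      Finset.card_le_card hsub
    by_cases h3 : deg G A v = 3
    swap
    · omega
    by_contra hlt
    obtain ⟨x₁, hx₁, x₂, hx₂, hx⟩ := Finset.one_lt_card.1
      (show 1 < (A.filter fun x => G.Adj v x ∧ deg G A x = 2).card by omega)
    simp only [Finset.mem_filter] at hx₁ hx₂
    obtain ⟨hx₁A, hvx₁, hd₁⟩ := hx₁
    obtain ⟨hx₂A, hvx₂, hd₂⟩ := hx₂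
    obtain ⟨u₁, -, hu₁v, hxu₁, hn₁⟩ := exists_other_nbr hd₁ hvA hvx₁.symm
    obtain ⟨u₂, -, hu₂v, hxu₂, hn₂⟩ := exists_other_nbr hd₂ hvA hvx₂.symm
    obtain ⟨w, hw⟩ : ∃ w, ((A.filter (G.Adj v)).erase x₁).erase x₂ = {w} := by
      rw [← Finset.card_eq_one, Finset.card_erase_of_mem, Finset.card_erase_of_mem]
      · unfold deg at h3; omega
      · simp [hx₁A, hvx₁]
      · simp [hx₂A, hvx₂, hx.symm]
    refine hA (HasGood.of_deg_three_of_two (w := w) le_rfl hvA hx₁A hx₂A hx hvx₁ hvx₂ ?_ hn₁ hn₂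
      hu₁v hu₂v hxu₁ hxu₂ (hind _ hx₁A _ hx₂A hd₁ hd₂) (hmin _ ?_))
    · intro z hz hvz
      by_contra! hcon
      have : z ∈ ((A.filter (G.Adj v)).erase x₁).erase x₂ := by simp [hz, hvz, hcon.1, hcon.2.1]
      rw [hw, Finset.mem_singleton] at this
      exact hcon.2.2 this
    · refine Finset.sdiff_ssubset ?_ (by simp)
      intro z hz; simp only [Finset.mem_insert, Finset.mem_singleton] at hz
      rcases hz with rfl | rfl | rfl <;> assumption
  have h1 := two_mul_card_deg_two_le hind
  have h2 := Finset.sum_le_sum hv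
  rw [Finset.sum_add_distrib, ← Finset.mul_sum, Finset.sum_const, smul_eq_mul] at h2
  have h3 := hs A hne
  have h4 := sum_deg_eq (G := G) (A := A)
  have h5 := Finset.card_filter_add_card_filter_not (s := A) (deg G A · = 2)
  omega

/-- Graphs of maximum average degree less than `5/2`: in a minimal counterexample, vertices of
degree two are independent, and a vertex of degree three has at most two of them as neighbors. So
if each vertex of degree two receives `1/4` from both neighbors, all charges are at least `5/2`. -/
theorem hasGood_five (hs : ∀ X : Finset V, X.Nonempty → 2 * ∑ v ∈ X, deg G X v < 5 * X.card)
    (A : Finset V) : HasGood 5 G A ∅ := by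
  induction A using Finset.strongInduction with
  | H A hmin =>
  by_contra hA
  have hne : A.Nonempty := by
    rw [Finset.nonempty_iff_ne_empty]; rintro rfl; exact hA (HasGood.empty (by omega) _)
  have hdeg := two_le_deg_of_minimal (by omega) hmin hA
  have hind := not_adj_deg_two_of_minimal (by omega) hmin hA
  have hv : ∀ v ∈ A.filter (¬ deg G A · = 2),
      (A.filter fun x => G.Adj v x ∧ deg G A x = 2).card + 10 ≤ 4 * deg G A v := by
    intro v hv
    obtain ⟨hvA, hv2⟩ := Finset.mem_filter.1 hv
    have h2 := hdeg v hvA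
    have hsub : (A.filter fun x => G.Adj v x ∧ deg G A x = 2) ⊆ A.filter (G.Adj v) := by
      intro x; simp only [Finset.mem_filter]; exact fun h => ⟨h.1, h.2.1⟩
    have hle : (A.filter fun x => G.Adj v x ∧ deg G A x = 2).card ≤ deg G A v :=
      Finset.card_le_card hsub
    by_cases h3 : deg G A v = 3
    swap
    · omega
    by_contra hlt
    have heq := Finset.eq_of_subset_of_card_le hsub
      (show deg G A v ≤ (A.filter fun x => G.Adj v x ∧ deg G A x = 2).card by omega)
    have hx2 : ∀ x ∈ A, G.Adj v x → deg G A x = 2 := fun x hx hvx =>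
      (Finset.mem_filter.1 (heq.symm ▸ Finset.mem_filter.2 ⟨hx, hvx⟩ :
        x ∈ A.filter fun x => G.Adj v x ∧ deg G A x = 2)).2.2
    let e := (Finset.equivFinOfCardEq h3).symm
    have hxm : ∀ i, (e i : V) ∈ A ∧ G.Adj v (e i) := fun i => Finset.mem_filter.1 (e i).2
    choose u huA huv hxu hxn using fun i => exists_other_nbr
      (hx2 _ (hxm i).1 (hxm i).2) hvA (hxm i).2.symm
    refine hA (HasGood.of_deg_three_of_three (x := fun i => (e i : V)) (u := u) le_rfl hvA
      (fun i => (hxm i).1) (Subtype.val_injective.comp e.injective)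
      (fun i => (hxm i).2) ?_ hxn huv hxu ?_ ?_ (hmin _ ?_))
    · intro z hz hvz
      exact ⟨e.symm ⟨z, Finset.mem_filter.2 ⟨hz, hvz⟩⟩, by simp⟩
    · intro i j
      exact hind _ (hxm i).1 _ (hxm j).1 (hx2 _ (hxm i).1 (hxm i).2) (hx2 _ (hxm j).1 (hxm j).2)
    · intro i
      have h1 := hdeg _ (huA i)
      have h2 : deg G A (u i) ≠ 2 := fun h =>
        hind _ (hxm i).1 _ (huA i) (hx2 _ (hxm i).1 (hxm i).2) h (hxu i)
      omega
    · refine Finset.sdiff_ssubset ?_ (by simp)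
      intro z hz
      simp only [Finset.mem_insert, Finset.mem_image, Finset.mem_univ, true_and] at hz
      rcases hz with rfl | ⟨i, rfl⟩
      · exact hvA
      · exact (hxm i).1
  have h1 := two_mul_card_deg_two_le hind
  have h2 := Finset.sum_le_sum hv
  rw [Finset.sum_add_distrib, ← Finset.mul_sum, Finset.sum_const, smul_eq_mul] at h2
  have h3 := hs A hne
  have h4 := sum_deg_eq (G := G) (A := A)
  have h5 := Finset.card_filter_add_card_filter_not (s := A) (deg G A · = 2)
  omega

/-! ### Reducible configurations and counting for four colors -/

/-- `p` enumerates, in cyclic order, a component of `G[A]` that is a cycle of length `n ≥ 3`. -/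
structure IsCycleIn (G : SimpleGraph V) (A : Finset V) {n : ℕ} [NeZero n] (p : Fin n → V) :
    Prop where
  inj : Function.Injective p
  mem : ∀ i, p i ∈ A
  adj : ∀ i, ∀ z ∈ A, G.Adj (p i) z ↔ z = p (i + 1) ∨ z = p (i - 1)

theorem IsCycleIn.of_sdiff {A S : Finset V} {n : ℕ} [NeZero n] {p : Fin n → V}
    (hp : IsCycleIn G (A \ S) p) (h : ∀ i, ∀ s ∈ S, ¬ G.Adj (p i) s) : IsCycleIn G A p := by
  refine ⟨hp.inj, fun i => (Finset.mem_sdiff.1 (hp.mem i)).1, fun i z hz => ?_⟩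
  by_cases hzS : z ∈ S
  · refine ⟨fun hadj => absurd hadj (h i z hzS), ?_⟩
    rintro (rfl | rfl)
    · exact absurd hzS (Finset.mem_sdiff.1 (hp.mem _)).2
    · exact absurd hzS (Finset.mem_sdiff.1 (hp.mem _)).2
  · exact hp.adj i z (Finset.mem_sdiff.2 ⟨hz, hzS⟩)

theorem IsCycleIn.rotate {A : Finset V} {n : ℕ} [NeZero n] {p : Fin n → V}
    (hp : IsCycleIn G A p) (i : Fin n) : IsCycleIn G A fun j => p (i + j) := by
  refine ⟨fun a b h => add_left_cancel (hp.inj h), fun j => hp.mem _, fun j z hz => ?_⟩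
  rw [hp.adj _ z hz, add_assoc, add_sub_assoc]

/-- A cycle component is colored by a cyclic sequence of colors in which any two entries at distance
one or two differ, except that the two neighbors of a vertex in `F` may share their color. -/
theorem HasGood.of_isCycleIn {A : Finset V} {F : Set V} {n : ℕ} [NeZero n] {p : Fin n → V}
    (hp : IsCycleIn G A p) (γ : Fin n → Fin k) (h₁ : ∀ j, γ j ≠ γ (j + 1))
    (h₂ : ∀ j, γ (j + 1) = γ (j - 1) → p j ∈ F)
    (h : HasGood k G (A \ Finset.univ.image p) F) : HasGood k G A F := by
  obtain ⟨φ, hφ⟩ := h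
  have hS : ∀ z, z ∈ Finset.univ.image p ↔ ∃ i, z = p i := by intro z; simp [eq_comm]
  have hsub : Finset.univ.image p ⊆ A := by
    intro z hz
    obtain ⟨i, rfl⟩ := (hS z).1 hz
    exact hp.mem i
  obtain ⟨f, hf⟩ := hφ.extend (A := A) (S := Finset.univ.image p) (F := F)
    (Finset.sdiff_union_of_subset hsub).symm (fun w hw => Or.inl hw)
  obtain ⟨ψ, hψ⟩ : ∃ ψ : V → Fin k, ψ = Function.extend p γ φ := ⟨_, rfl⟩
  have hψp : ∀ i, ψ (p i) = γ i := fun i => by rw [hψ, hp.inj.extend_apply]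
  have hno : ∀ i, ∀ w ∈ A \ Finset.univ.image p, ¬ G.Adj (p i) w := by
    intro i w hw hadj
    obtain ⟨hwA, hwS⟩ := Finset.mem_sdiff.1 hw
    rcases (hp.adj i w hwA).1 hadj with rfl | rfl <;> exact hwS ((hS _).2 ⟨_, rfl⟩)
  refine ⟨ψ, hf ψ ?_ ?_ ?_ ?_ ?_⟩
  · intro w hw
    rw [hψ, Function.extend_apply']
    rintro ⟨i, rfl⟩
    exact (Finset.mem_sdiff.1 hw).2 ((hS _).2 ⟨_, rfl⟩)
  · intro s hs t ht hst
    obtain ⟨i, rfl⟩ := (hS s).1 hs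
    rcases (hp.adj i t (hsub ht)).1 hst with rfl | rfl
    · rw [hψp, hψp]; exact h₁ i
    · rw [hψp, hψp]
      have := h₁ (i - 1)
      rw [sub_add_cancel] at this
      exact this.symm
  · intro s hs w hw hsw
    obtain ⟨i, rfl⟩ := (hS s).1 hs
    exact absurd hsw (hno i w hw)
  · intro s hs
    obtain ⟨i, rfl⟩ := (hS s).1 hs
    by_cases he : γ (i + 1) = γ (i - 1)
    · refine Or.inr ⟨⟨γ (i + 1), fun w hw hadj => ?_⟩, Or.inl (h₂ i he)⟩
      rcases (hp.adj i w hw).1 hadj with rfl | rfl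
      · rw [hψp]
      · rw [hψp, he]
    · left
      refine SatAt.of_pair (hp.mem (i + 1)) ((hp.adj i _ (hp.mem _)).2 (Or.inl rfl))
        (fun z hz hadj => (hp.adj i z hz).1 hadj) ?_
      rwa [hψp, hψp]
  · rintro w hw - ⟨s, hs, hws⟩
    obtain ⟨i, rfl⟩ := (hS s).1 hs
    exact absurd hws.symm (hno i w hw)

/-- Four interior vertices of a path can be colored subject to the constraints at its ends: `a`,
`b` are the colors of the ends and `a'`, `b'` the further colors to be avoided next to them. -/
theorem exists_path_coloring (a a' b b' : Fin 4) : ∃ c : Fin 4 → Fin 4,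
    (c 0 ≠ a ∧ c 0 ≠ a' ∧ c 3 ≠ b ∧ c 3 ≠ b') ∧ (c 0 ≠ c 1 ∧ c 1 ≠ c 2 ∧ c 2 ≠ c 3) ∧
      (a ≠ c 1 ∧ c 0 ≠ c 2 ∧ c 1 ≠ c 3 ∧ c 2 ≠ b) := by
  by_cases h : ∃ c, c ∉ [a, a', b, b']
  · -- a color `c` admissible at both ends can be used twice
    obtain ⟨c, hc⟩ := h
    obtain ⟨d, hd⟩ := exists_avoiding [c, a] (by simp)
    obtain ⟨e, he⟩ := exists_avoiding [c, b, d] (by simp)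
    simp only [List.mem_cons, List.not_mem_nil, or_false, not_or] at hc hd he
    refine ⟨![c, d, e, c], ?_⟩
    simp only [Matrix.cons_val]
    grind
  · -- otherwise `a, a', b, b'` are all the colors
    push Not at h
    refine ⟨![b, a', b', a], ?_⟩
    have h4 : [a, a', b, b'].Nodup := by
      revert a a' b b'
      decide
    simp only [List.nodup_cons, List.mem_cons, List.not_mem_nil, or_false, not_or] at h4
    simp only [Matrix.cons_val]
    grind

/-- A path of four vertices of degree two is reducible. If both its ends are attached to the same
vertex `u`, then `u` must not rely on the exemption, as its two new neighbors may share a color. -/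
theorem HasGood.of_path {A : Finset V} {F F' : Set V} {x : Fin 4 → V} {u w : V}
    (hx : Function.Injective x) (hxA : ∀ i, x i ∈ A)
    (h01 : G.Adj (x 0) (x 1)) (h12 : G.Adj (x 1) (x 2)) (h23 : G.Adj (x 2) (x 3))
    (h0u : G.Adj (x 0) u) (h3w : G.Adj (x 3) w)
    (hu : ∀ i, u ≠ x i) (hw : ∀ i, w ≠ x i)
    (hn0 : ∀ z ∈ A, G.Adj (x 0) z → z = x 1 ∨ z = u)
    (hn1 : ∀ z ∈ A, G.Adj (x 1) z → z = x 0 ∨ z = x 2)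
    (hn2 : ∀ z ∈ A, G.Adj (x 2) z → z = x 1 ∨ z = x 3)
    (hn3 : ∀ z ∈ A, G.Adj (x 3) z → z = x 2 ∨ z = w)
    (hF : ∀ v ∈ F', v ∈ F ∨ ∃ s ∈ Finset.univ.image x, G.Adj v s)
    (huw : u = w → u ∉ F' ∧ ∃ z ∈ A \ Finset.univ.image x, G.Adj u z)
    (h : HasGood 4 G (A \ Finset.univ.image x) F') : HasGood 4 G A F := by
  obtain ⟨φ, hφ⟩ := h
  have hS : ∀ z, z ∈ Finset.univ.image x ↔ ∃ i, z = x i := by intro z; simp [eq_comm]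
  have hsub : Finset.univ.image x ⊆ A := by
    intro z hz
    obtain ⟨i, rfl⟩ := (hS z).1 hz
    exact hxA i
  have hout : ∀ z ∈ A \ Finset.univ.image x, ∀ i, z ≠ x i := by
    rintro z hz i rfl
    exact (Finset.mem_sdiff.1 hz).2 ((hS _).2 ⟨i, rfl⟩)
  obtain ⟨f, hf⟩ := hφ.extend (A := A) (S := Finset.univ.image x) (F := F)
    (Finset.sdiff_union_of_subset hsub).symm hF
  obtain ⟨c, ⟨h1, h2, h3, h4⟩, ⟨h5, h6, h7⟩, h8, h9, h10, h11⟩ :=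
    exists_path_coloring (φ u) (f u) (φ w) (f w)
  obtain ⟨ψ, hψ⟩ : ∃ ψ : V → Fin 4, ψ = Function.extend x c φ := ⟨_, rfl⟩
  have hψx : ∀ i, ψ (x i) = c i := fun i => by rw [hψ, hx.extend_apply]
  have hψo : ∀ z, (∀ i, z ≠ x i) → ψ z = φ z := fun z hz => by
    rw [hψ, Function.extend_apply' _ _ _ (by rintro ⟨i, hi⟩; exact hz i hi.symm)]
  have hout0 : ∀ z ∈ A \ Finset.univ.image x, G.Adj (x 0) z → z = u := fun z hz hadj =>
    (hn0 z (Finset.mem_sdiff.1 hz).1 hadj).resolve_left (hout z hz 1)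
  have hout3 : ∀ z ∈ A \ Finset.univ.image x, G.Adj (x 3) z → z = w := fun z hz hadj =>
    (hn3 z (Finset.mem_sdiff.1 hz).1 hadj).resolve_left (hout z hz 2)
  have hout12 : ∀ z ∈ A \ Finset.univ.image x, ¬ G.Adj (x 1) z ∧ ¬ G.Adj (x 2) z := by
    refine fun z hz => ⟨fun hadj => ?_, fun hadj => ?_⟩
    · exact (hn1 z (Finset.mem_sdiff.1 hz).1 hadj).elim (hout z hz 0) (hout z hz 2)
    · exact (hn2 z (Finset.mem_sdiff.1 hz).1 hadj).elim (hout z hz 1) (hout z hz 3)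
  refine ⟨ψ, hf ψ (fun z hz => hψo z (hout z hz)) ?_ ?_ ?_ ?_⟩
  · have hadj : ∀ i, ∀ t ∈ Finset.univ.image x, G.Adj (x i) t → ψ (x i) ≠ ψ t := by
      intro i t ht hadj
      have htA := hsub ht
      have htS := (hS t).1 ht
      have hcase : ∃ j, t = x j ∧ c i ≠ c j := by
        fin_cases i
        · rcases hn0 t htA hadj with rfl | rfl
          · exact ⟨1, rfl, h5⟩
          · exact absurd htS (by simpa using hu)
        · rcases hn1 t htA hadj with rfl | rfl
          · exact ⟨0, rfl, h5.symm⟩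
          · exact ⟨2, rfl, h6⟩
        · rcases hn2 t htA hadj with rfl | rfl
          · exact ⟨1, rfl, h6.symm⟩
          · exact ⟨3, rfl, h7⟩
        · rcases hn3 t htA hadj with rfl | rfl
          · exact ⟨2, rfl, h7.symm⟩
          · exact absurd htS (by simpa using hw)
      obtain ⟨j, rfl, hc⟩ := hcase
      rwa [hψx, hψx]
    intro s hs t ht hst
    obtain ⟨i, rfl⟩ := (hS s).1 hs
    exact hadj i t ht hst
  · intro s hs z hz hsz
    obtain ⟨i, rfl⟩ := (hS s).1 hs
    rw [hψx]
    fin_cases i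
    · obtain rfl := hout0 z hz hsz
      exact ⟨h1, h2⟩
    · exact absurd hsz (hout12 z hz).1
    · exact absurd hsz (hout12 z hz).2
    · obtain rfl := hout3 z hz hsz
      exact ⟨h3, h4⟩
  · intro s hs
    left
    obtain ⟨i, rfl⟩ := (hS s).1 hs
    fin_cases i
    · refine SatAt.of_pair (hxA 1) h01 hn0 ?_
      rw [hψx, hψo u hu]; exact h8.symm
    · refine SatAt.of_pair (hxA 0) h01.symm hn1 ?_
      rw [hψx, hψx]; exact h9
    · refine SatAt.of_pair (hxA 1) h12.symm hn2 ?_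
      rw [hψx, hψx]; exact h10
    · refine SatAt.of_pair (hxA 2) h23.symm hn3 ?_
      rw [hψx, hψo w hw]; exact h11
  · intro z hz hweak hex
    refine SatAt.of_injOn hex fun s hs t ht hzs hzt _ => ?_
    have hend : ∀ s ∈ Finset.univ.image x, G.Adj z s → s = x 0 ∧ z = u ∨ s = x 3 ∧ z = w := by
      intro s hs hzs
      obtain ⟨i, rfl⟩ := (hS s).1 hs
      fin_cases i
      · exact Or.inl ⟨rfl, hout0 z hz hzs.symm⟩
      · exact absurd hzs.symm (hout12 z hz).1
      · exact absurd hzs.symm (hout12 z hz).2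
      · exact Or.inr ⟨rfl, hout3 z hz hzs.symm⟩
    have hne : ¬ (z = u ∧ z = w) := by
      rintro ⟨hzu, hzw⟩
      obtain ⟨huF, y, hy, huy⟩ := huw (hzu.symm.trans hzw)
      rw [hzu] at hweak
      exact hweak.elim huF fun h => h y hy huy
    rcases hend s hs hzs with ⟨rfl, h⟩ | ⟨rfl, h⟩ <;>
      rcases hend t ht hzt with ⟨rfl, h'⟩ | ⟨rfl, h'⟩
    · rfl
    · exact absurd ⟨h, h'⟩ hne
    · exact absurd ⟨h', h⟩ hne
    · rfl

theorem card_le_deg {A T : Finset V} {v : V} (h : ∀ z ∈ T, z ∈ A ∧ G.Adj v z) :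
    T.card ≤ deg G A v :=
  Finset.card_le_card fun z hz => Finset.mem_filter.2 (h z hz)

/-- If no trail of four vertices of degree two exists, then tracing the darts that leave vertices of
degree two backwards reaches, within three steps, a dart that leaves a vertex of another degree. Hence there are at most three times as many of the former as
there are of the latter. -/
theorem sum_deg_two_le {A : Finset V}
    (hno : ∀ x₁ ∈ A, ∀ x₂ ∈ A, ∀ x₃ ∈ A, ∀ x₄ ∈ A, deg G A x₁ = 2 → deg G A x₂ = 2 →
      deg G A x₃ = 2 → deg G A x₄ = 2 → G.Adj x₁ x₂ → G.Adj x₂ x₃ → G.Adj x₃ x₄ →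
      x₃ ≠ x₁ → x₄ ≠ x₂ → False) :
    2 * (A.filter (deg G A · = 2)).card ≤
      3 * ∑ v ∈ A.filter (¬ deg G A · = 2), deg G A v := by
  have hother : ∀ v a, ∃ b, v ∈ A → deg G A v = 2 → a ∈ A → G.Adj v a →
      b ∈ A ∧ b ≠ a ∧ G.Adj v b ∧ ∀ z ∈ A, G.Adj v z → z = a ∨ z = b := by
    intro v a
    by_cases h : v ∈ A ∧ deg G A v = 2 ∧ a ∈ A ∧ G.Adj v a
    · obtain ⟨b, hb⟩ := exists_other_nbr h.2.1 h.2.2.1 h.2.2.2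
      exact ⟨b, fun _ _ _ _ => hb⟩
    · exact ⟨v, fun h1 h2 h3 h4 => absurd ⟨h1, h2, h3, h4⟩ h⟩
  choose o ho using hother
  let D₂ : Finset (Σ _ : V, V) := (A.filter (deg G A · = 2)).sigma fun v => A.filter (G.Adj v)
  let D₃ : Finset (Σ _ : V, V) := (A.filter (¬ deg G A · = 2)).sigma fun v => A.filter (G.Adj v)
  -- a dart `x → y` from a vertex of degree two is preceded by the dart into `x` not coming from `y`
  let prev : (Σ _ : V, V) → Σ _ : V, V := fun p => ⟨o p.1 p.2, p.1⟩
  have hD₂ : ∀ p, p ∈ D₂ ↔ (p.1 ∈ A ∧ deg G A p.1 = 2) ∧ p.2 ∈ A ∧ G.Adj p.1 p.2 := by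
    intro p; simp [D₂]
  have hD₃ : ∀ p, p ∈ D₃ ↔ (p.1 ∈ A ∧ ¬ deg G A p.1 = 2) ∧ p.2 ∈ A ∧ G.Adj p.1 p.2 := by
    intro p; simp [D₃]
  have hprev : ∀ p ∈ D₂, prev p ∈ D₂ ∨ prev p ∈ D₃ := by
    intro p hp
    obtain ⟨⟨h1, h2⟩, h3, h4⟩ := (hD₂ p).1 hp
    obtain ⟨hb, -, hadj, -⟩ := ho _ _ h1 h2 h3 h4
    rw [hD₂, hD₃]
    by_cases hd : deg G A (o p.1 p.2) = 2
    · exact Or.inl ⟨⟨hb, hd⟩, h1, hadj.symm⟩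
    · exact Or.inr ⟨⟨hb, hd⟩, h1, hadj.symm⟩
  have hinj : Set.InjOn prev D₂ := by
    rintro ⟨x, y⟩ hp ⟨x', y'⟩ hq he
    obtain ⟨⟨h1, h2⟩, h3, h4⟩ := (hD₂ _).1 hp
    obtain ⟨-, h3', h4'⟩ := (hD₂ _).1 hq
    simp only [prev, Sigma.mk.injEq, heq_eq_eq] at he h1 h2 h3 h4 h3' h4' ⊢
    obtain ⟨he, rfl⟩ := he
    refine ⟨rfl, ?_⟩
    have h5 := (ho x y' h1 h2 h3' h4').2.2.2 y h3 h4
    have h6 := (ho x y h1 h2 h3 h4).2.1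
    rcases h5 with h5 | h5
    · exact h5
    · exact absurd (he.trans h5.symm) h6
  have hcard : ∀ T : Finset (Σ _ : V, V), (D₂.filter (prev · ∈ T)).card ≤ T.card := fun T =>
    Finset.card_le_card_of_injOn prev (fun p hp => (Finset.mem_filter.1 hp).2)
      (hinj.mono (by intro p hp; exact (Finset.mem_filter.1 hp).1))
  let T₁ := D₂.filter (prev · ∈ D₃)
  let T₂ := D₂.filter (prev · ∈ T₁)
  let T₃ := D₂.filter (prev · ∈ T₂)
  have hcover : D₂ ⊆ T₁ ∪ T₂ ∪ T₃ := by
    intro p hp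
    simp only [Finset.mem_union, T₁, T₂, T₃, Finset.mem_filter]
    rcases hprev p hp with h1 | h1
    swap
    · exact Or.inl (Or.inl ⟨hp, h1⟩)
    rcases hprev _ h1 with h2 | h2
    swap
    · exact Or.inl (Or.inr ⟨hp, h1, h2⟩)
    rcases hprev _ h2 with h3 | h3
    swap
    · exact Or.inr ⟨hp, h1, h2, h3⟩
    exfalso
    obtain ⟨⟨a1, a2⟩, a3, a4⟩ := (hD₂ _).1 hp
    obtain ⟨⟨b1, b2⟩, b3, b4⟩ := (hD₂ _).1 h1
    obtain ⟨⟨c1, c2⟩, c3, c4⟩ := (hD₂ _).1 h2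
    obtain ⟨⟨d1, d2⟩, d3, d4⟩ := (hD₂ _).1 h3
    exact hno _ a1 _ b1 _ c1 _ d1 a2 b2 c2 d2 b4.symm c4.symm d4.symm
      (ho _ _ b1 b2 b3 b4).2.1 (ho _ _ c1 c2 c3 c4).2.1
  have h1 : T₁.card ≤ D₃.card := hcard _
  have h2 : T₂.card ≤ T₁.card := hcard _
  have h3 : T₃.card ≤ T₂.card := hcard _
  have h4 := Finset.card_le_card hcover
  have h5 := Finset.card_union_le (T₁ ∪ T₂) T₃
  have h6 := Finset.card_union_le T₁ T₂
  have h7 : D₂.card = 2 * (A.filter (deg G A · = 2)).card := by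
    rw [Finset.card_sigma]
    change ∑ v ∈ _, deg G A v = _
    rw [Finset.sum_congr rfl (g := fun _ => 2) (fun v hv => (Finset.mem_filter.1 hv).2)]
    simp [mul_comm]
  have h8 : D₃.card = ∑ v ∈ A.filter (¬ deg G A · = 2), deg G A v := Finset.card_sigma _ _
  omega

/-- Two cycles of length five that share a single vertex span nine vertices and ten edges, which is
too dense. -/
theorem IsCycleIn.apply_ne_of_path
    (hs : ∀ X : Finset V, X.Nonempty → 11 * ∑ v ∈ X, deg G X v < 24 * X.card)
    {A : Finset V} {x : Fin 4 → V} {u : V} (hx : Function.Injective x)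
    (h01 : G.Adj (x 0) (x 1)) (h12 : G.Adj (x 1) (x 2)) (h23 : G.Adj (x 2) (x 3))
    (h0u : G.Adj (x 0) u) (h3u : G.Adj (x 3) u)
    {q : Fin 5 → V} (hq : IsCycleIn G (A \ Finset.univ.image x) q) (i : Fin 5) : q i ≠ u := by
  rintro rfl
  obtain ⟨X, hX⟩ : ∃ X, X = Finset.univ.image q ∪ Finset.univ.image x := ⟨_, rfl⟩
  have hqX : ∀ j, q j ∈ X := fun j => by simp [hX]
  have hxX : ∀ j, x j ∈ X := fun j => by simp [hX]
  have hqx : ∀ j l, q j ≠ x l := fun j l h =>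
    (Finset.mem_sdiff.1 (hq.mem j)).2 (by simp [h])
  have hcard : X.card = 9 := by
    rw [hX, Finset.card_union_of_disjoint, Finset.card_image_of_injective _ hq.inj,
      Finset.card_image_of_injective _ hx]
    · simp
    · rw [Finset.disjoint_left]
      intro z hz hz'
      simp only [Finset.mem_image, Finset.mem_univ, true_and] at hz hz'
      obtain ⟨j, rfl⟩ := hz
      obtain ⟨l, hl⟩ := hz'
      exact hqx j l hl.symm
  have hqa : ∀ j, G.Adj (q j) (q (j + 1)) := fun j => (hq.adj j _ (hq.mem _)).2 (Or.inl rfl)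
  have hqb : ∀ j, G.Adj (q j) (q (j - 1)) := fun j => (hq.adj j _ (hq.mem _)).2 (Or.inr rfl)
  have hpm : ∀ j : Fin 5, j + 1 ≠ j - 1 := by decide
  have htwo : ∀ v a b, a ∈ X → b ∈ X → G.Adj v a → G.Adj v b → a ≠ b → 2 ≤ deg G X v := by
    intro v a b ha hb h1 h2 hab
    rw [← Finset.card_pair hab]
    refine card_le_deg fun z hz => ?_
    simp only [Finset.mem_insert, Finset.mem_singleton] at hz
    rcases hz with rfl | rfl
    · exact ⟨ha, h1⟩
    · exact ⟨hb, h2⟩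
  have hdeg : ∀ v ∈ X, 2 + (if v = q i then 2 else 0) ≤ deg G X v := by
    intro v hv
    split_ifs with hvi
    · subst hvi
      have h4 : ({q (i + 1), q (i - 1), x 0, x 3} : Finset V).card = 4 := by
        rw [Finset.card_insert_of_notMem, Finset.card_insert_of_notMem, Finset.card_pair]
        · exact hx.ne (by decide)
        · simp [hqx]
        · simp [hqx, hq.inj.ne (hpm i)]
      rw [show 2 + 2 = 4 from rfl, ← h4]
      refine card_le_deg fun z hz => ?_
      simp only [Finset.mem_insert, Finset.mem_singleton] at hz
      rcases hz with rfl | rfl | rfl | rfl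
      · exact ⟨hqX _, hqa i⟩
      · exact ⟨hqX _, hqb i⟩
      · exact ⟨hxX _, h0u.symm⟩
      · exact ⟨hxX _, h3u.symm⟩
    · rw [hX, Finset.mem_union] at hv
      simp only [Finset.mem_image, Finset.mem_univ, true_and] at hv
      rcases hv with ⟨j, rfl⟩ | ⟨j, rfl⟩
      · exact htwo _ _ _ (hqX _) (hqX _) (hqa j) (hqb j) (hq.inj.ne (hpm j))
      · fin_cases j
        · exact htwo _ _ _ (hxX 1) (hqX i) h01 h0u (hqx _ _).symm
        · exact htwo _ _ _ (hxX 0) (hxX 2) h01.symm h12 (hx.ne (by decide))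
        · exact htwo _ _ _ (hxX 1) (hxX 3) h12.symm h23 (hx.ne (by decide))
        · exact htwo _ _ _ (hxX 2) (hqX i) h23.symm h3u (hqx _ _).symm
  have hsum := Finset.sum_le_sum hdeg
  rw [Finset.sum_add_distrib, Finset.sum_ite_eq', if_pos (hqX i)] at hsum
  simp only [Finset.sum_const, smul_eq_mul, hcard] at hsum
  have := hs X ⟨_, hqX i⟩
  omega

theorem IsCycleIn.of_sdiff_image {A : Finset V} {m n : ℕ} [NeZero m] [NeZero n] {p : Fin m → V}
    {q : Fin n → V} (hp : IsCycleIn G A p) (hq : IsCycleIn G (A \ Finset.univ.image p) q) :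
    IsCycleIn G A q := by
  refine hq.of_sdiff fun i s hs hadj => ?_
  obtain ⟨j, -, rfl⟩ := Finset.mem_image.1 hs
  obtain ⟨hqA, hqS⟩ := Finset.mem_sdiff.1 (hq.mem i)
  rcases (hp.adj j _ hqA).1 hadj.symm with h | h <;> exact hqS (by simp [h])

theorem IsCycleIn.mem_nbrs_or {A S : Finset V} {n : ℕ} [NeZero n] {q : Fin n → V}
    (hq : IsCycleIn G (A \ S) q) : (∃ i, q i ∈ nbrs G S) ∨ IsCycleIn G A q := by
  by_cases h : ∃ i, q i ∈ nbrs G S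
  · exact Or.inl h
  · exact Or.inr (hq.of_sdiff fun i s hs hadj => h ⟨i, s, hs, hadj⟩)

theorem sdiff_image_ssubset {A : Finset V} {n : ℕ} [NeZero n] {p : Fin n → V}
    (h : ∀ i, p i ∈ A) : A \ Finset.univ.image p ⊂ A := by
  refine Finset.sdiff_ssubset ?_ ⟨p 0, by simp⟩
  intro z hz
  obtain ⟨i, -, rfl⟩ := Finset.mem_image.1 hz
  exact h i

theorem adj_iff_of_pair {A : Finset V} {v a b : V} (ha : G.Adj v a) (hb : G.Adj v b)
    (h : ∀ z ∈ A, G.Adj v z → z = a ∨ z = b) : ∀ z ∈ A, G.Adj v z ↔ z = a ∨ z = b := by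
  refine fun z hz => ⟨h z hz, ?_⟩
  rintro (rfl | rfl) <;> assumption

/-- The reducible configurations given by a trail of four vertices of degree two: a triangle, a
cycle of length four, or a path. -/
theorem HasGood.of_trail
    (hs : ∀ X : Finset V, X.Nonempty → 11 * ∑ v ∈ X, deg G X v < 24 * X.card)
    {A : Finset V} {F : Set V} (hC : ∀ p : Fin 5 → V, ¬ IsCycleIn G A p)
    {x₁ x₂ x₃ x₄ : V} (hx₁ : x₁ ∈ A) (hx₂ : x₂ ∈ A) (hx₃ : x₃ ∈ A) (hx₄ : x₄ ∈ A)
    (hd₁ : deg G A x₁ = 2) (hd₂ : deg G A x₂ = 2) (hd₃ : deg G A x₃ = 2) (hd₄ : deg G A x₄ = 2)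
    (h₁₂ : G.Adj x₁ x₂) (h₂₃ : G.Adj x₂ x₃) (h₃₄ : G.Adj x₃ x₄) (h₃₁ : x₃ ≠ x₁) (h₄₂ : x₄ ≠ x₂)
    (hmin : ∀ B ⊂ A, ∀ F : Set V, (∀ p : Fin 5 → V, IsCycleIn G B p → ∃ i, p i ∈ F) →
      HasGood 4 G B F) : HasGood 4 G A F := by
  have hclosed : ∀ {n : ℕ} [NeZero n] (p : Fin n → V), IsCycleIn G A p →
      HasGood 4 G (A \ Finset.univ.image p) F := fun p hp =>
    hmin _ (sdiff_image_ssubset hp.mem) F fun q hq => absurd (hp.of_sdiff_image hq) (hC q)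
  obtain ⟨u, huA, hux₂, h₁u, hn₁⟩ := exists_other_nbr hd₁ hx₂ h₁₂
  obtain ⟨w, hwA, hwx₃, h₄w, hn₄⟩ := exists_other_nbr hd₄ hx₃ h₃₄.symm
  have hn₂ : ∀ z ∈ A, G.Adj x₂ z → z = x₁ ∨ z = x₃ := by
    obtain ⟨b, -, -, -, hn⟩ := exists_other_nbr hd₂ hx₁ h₁₂.symm
    obtain rfl := (hn x₃ hx₃ h₂₃).resolve_left h₃₁
    exact hn
  have hn₃ : ∀ z ∈ A, G.Adj x₃ z → z = x₂ ∨ z = x₄ := by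
    obtain ⟨b, -, -, -, hn⟩ := exists_other_nbr hd₃ hx₂ h₂₃.symm
    obtain rfl := (hn x₄ hx₄ h₃₄).resolve_left h₄₂
    exact hn
  by_cases h₄₁ : x₄ = x₁
  · -- a triangle
    subst h₄₁
    obtain rfl := (hn₁ x₃ hx₃ h₃₄.symm).resolve_left h₂₃.ne'
    have hp : IsCycleIn G A ![x₄, x₂, x₃] := by
      refine ⟨?_, ?_, ?_⟩
      · intro i j h
        have := h₁₂.ne; have := h₂₃.ne; have := h₃₄.ne
        fin_cases i <;> fin_cases j <;> simp_all
      · intro i; fin_cases i <;> assumption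
      · intro i
        fin_cases i
        · exact adj_iff_of_pair h₁₂ h₁u hn₁
        · exact adj_iff_of_pair h₂₃ h₁₂.symm fun z hz h => (hn₂ z hz h).symm
        · exact adj_iff_of_pair h₃₄ h₂₃.symm fun z hz h => (hn₃ z hz h).symm
    exact HasGood.of_isCycleIn hp ![0, 1, 2] (by decide)
      (fun j h => absurd h (by revert j; decide)) (hclosed _ hp)
  have hinj : Function.Injective ![x₁, x₂, x₃, x₄] := by
    intro i j h
    have := h₁₂.ne; have := h₂₃.ne; have := h₃₄.ne
    fin_cases i <;> fin_cases j <;> simp_all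
  have hxA : ∀ i, ![x₁, x₂, x₃, x₄] i ∈ A := by
    intro i; fin_cases i <;> assumption
  by_cases hu₄ : u = x₄
  · -- a cycle of length four
    subst hu₄
    obtain rfl := (hn₄ x₁ hx₁ h₁u.symm).resolve_left h₃₁.symm
    have hp : IsCycleIn G A ![x₁, x₂, x₃, u] := by
      refine ⟨hinj, hxA, ?_⟩
      intro i
      fin_cases i
      · exact adj_iff_of_pair h₁₂ h₁u hn₁
      · exact adj_iff_of_pair h₂₃ h₁₂.symm fun z hz h => (hn₂ z hz h).symm
      · exact adj_iff_of_pair h₃₄ h₂₃.symm fun z hz h => (hn₃ z hz h).symm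
      · exact adj_iff_of_pair h₄w h₃₄.symm fun z hz h => (hn₄ z hz h).symm
    exact HasGood.of_isCycleIn hp ![0, 1, 2, 3] (by decide)
      (fun j h => absurd h (by revert j; decide)) (hclosed _ hp)
  have hu : ∀ i, u ≠ ![x₁, x₂, x₃, x₄] i := by
    intro i
    fin_cases i
    · exact h₁u.ne'
    · exact hux₂
    · rintro rfl
      exact (hn₃ x₁ hx₁ h₁u.symm).elim h₁₂.ne (Ne.symm h₄₁)
    · exact hu₄
  have hw : ∀ i, w ≠ ![x₁, x₂, x₃, x₄] i := by
    intro i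
    fin_cases i
    · rintro rfl
      exact (hn₁ x₄ hx₄ h₄w.symm).elim h₄₂ (Ne.symm hu₄)
    · rintro rfl
      exact (hn₂ x₄ hx₄ h₄w.symm).elim h₄₁ h₃₄.ne'
    · exact hwx₃
    · exact h₄w.ne'
  have hred := fun F' => HasGood.of_path (G := G) (A := A) (F := F) (F' := F') (u := u) (w := w)
    hinj hxA h₁₂ h₂₃ h₃₄ h₁u h₄w hu hw hn₁ hn₂ hn₃ hn₄
  by_cases huw : u = w
  · -- a cycle of length five through `u`, where `u` has further neighbors
    subst huw
    refine hred ∅ (fun v hv => absurd hv (Set.notMem_empty v)) (fun _ => ⟨Set.notMem_empty u, ?_⟩)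
      (hmin _ (sdiff_image_ssubset hxA) _ ?_)
    · by_contra! hno
      have hnu : ∀ z ∈ A, G.Adj u z → z = x₁ ∨ z = x₄ := by
        intro z hz huz
        by_cases hzS : z ∈ Finset.univ.image ![x₁, x₂, x₃, x₄]
        · obtain ⟨i, -, rfl⟩ := Finset.mem_image.1 hzS
          fin_cases i
          · exact Or.inl rfl
          · exact ((hn₂ u huA huz.symm).elim (hu 0) (hu 2)).elim
          · exact ((hn₃ u huA huz.symm).elim (hu 1) (hu 3)).elim
          · exact Or.inr rfl
        · exact absurd huz (hno z (Finset.mem_sdiff.2 ⟨hz, hzS⟩))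
      refine hC ![u, x₁, x₂, x₃, x₄] ⟨?_, ?_, ?_⟩
      · exact Fin.cons_injective_iff.2 ⟨by rintro ⟨i, hi⟩; exact hu i hi.symm, hinj⟩
      · intro i; fin_cases i <;> assumption
      · intro i
        fin_cases i
        · exact adj_iff_of_pair h₁u.symm h₄w.symm hnu
        · exact adj_iff_of_pair h₁₂ h₁u hn₁
        · exact adj_iff_of_pair h₂₃ h₁₂.symm fun z hz h => (hn₂ z hz h).symm
        · exact adj_iff_of_pair h₃₄ h₂₃.symm fun z hz h => (hn₃ z hz h).symm
        · exact adj_iff_of_pair h₄w h₃₄.symm fun z hz h => (hn₄ z hz h).symm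
    · intro q hq
      refine absurd (hq.of_sdiff fun i s hs' hadj => ?_) (hC q)
      have hqu := IsCycleIn.apply_ne_of_path hs hinj h₁₂ h₂₃ h₃₄ h₁u h₄w hq i
      obtain ⟨hqA, hqS⟩ := Finset.mem_sdiff.1 (hq.mem i)
      have hqx : ∀ l, q i ≠ ![x₁, x₂, x₃, x₄] l := fun l h => hqS (by rw [h]; simp)
      obtain ⟨j, -, rfl⟩ := Finset.mem_image.1 hs'
      fin_cases j
      · exact (hn₁ _ hqA hadj.symm).elim (hqx 1) hqu
      · exact (hn₂ _ hqA hadj.symm).elim (hqx 0) (hqx 2)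
      · exact (hn₃ _ hqA hadj.symm).elim (hqx 1) (hqx 3)
      · exact (hn₄ _ hqA hadj.symm).elim (hqx 2) hqu
  · refine hred (F ∪ nbrs G (Finset.univ.image ![x₁, x₂, x₃, x₄])) (fun v hv => hv)
      (fun h => absurd h huw) (hmin _ (sdiff_image_ssubset hxA) _ fun q hq => ?_)
    rcases hq.mem_nbrs_or with ⟨i, hi⟩ | hq
    · exact ⟨i, Or.inr hi⟩
    · exact absurd hq (hC q)

/-- Graphs of maximum average degree less than `24/11`, relative to a set `F` of exempt vertices that
meets every component isomorphic to the cycle of length five. When a set `S` is deleted, the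
neighbors of `S` become exempt, so that this hypothesis persists. -/
theorem hasGood_four (hs : ∀ X : Finset V, X.Nonempty → 11 * ∑ v ∈ X, deg G X v < 24 * X.card)
    (A : Finset V) : ∀ F : Set V, (∀ p : Fin 5 → V, IsCycleIn G A p → ∃ i, p i ∈ F) →
      HasGood 4 G A F := by
  induction A using Finset.strongInduction with
  | H A hmin =>
  intro F hF
  by_contra hA
  have hne : A.Nonempty := by
    rw [Finset.nonempty_iff_ne_empty]; rintro rfl; exact hA (HasGood.empty (by omega) _)
  have hC : ∀ p : Fin 5 → V, ¬ IsCycleIn G A p := by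
    intro p hp
    obtain ⟨i, hi⟩ := hF p hp
    have hp' := hp.rotate i
    -- only the vertex colored `0`, which is exempt, has two neighbors of the same color
    refine hA (HasGood.of_isCycleIn hp' ![0, 1, 2, 3, 1] (by decide) ?_
      (hmin _ (sdiff_image_ssubset hp'.mem) F fun q hq => hF q (hp'.of_sdiff_image hq)))
    intro j hj
    have : j = 0 := by revert j; decide
    simpa [this] using hi
  have hdeg : ∀ v ∈ A, 2 ≤ deg G A v := by
    intro v hv
    by_contra hlt
    refine hA (HasGood.of_deg_le_one (by omega) hv (by omega) (hmin _ ?_ _ fun q hq => ?_))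
    · exact Finset.sdiff_ssubset (by simpa using hv) (by simp)
    · rcases hq.mem_nbrs_or with ⟨i, hi⟩ | hq
      · exact ⟨i, Or.inr hi⟩
      · exact absurd hq (hC q)
  have h1 := sum_deg_two_le (G := G) (A := A)
    fun x₁ hx₁ x₂ hx₂ x₃ hx₃ x₄ hx₄ d₁ d₂ d₃ d₄ a₁ a₂ a₃ n₁ n₂ =>
      hA (HasGood.of_trail hs hC hx₁ hx₂ hx₃ hx₄ d₁ d₂ d₃ d₄ a₁ a₂ a₃ n₁ n₂ hmin)
  have h2 : ∑ v ∈ A.filter (¬ deg G A · = 2), 3 ≤ ∑ v ∈ A.filter (¬ deg G A · = 2), deg G A v := by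
    refine Finset.sum_le_sum fun v hv => ?_
    obtain ⟨hvA, hv2⟩ := Finset.mem_filter.1 hv
    have := hdeg v hvA
    omega
  rw [Finset.sum_const, smul_eq_mul] at h2
  have h3 := hs A hne
  have h4 := sum_deg_eq (G := G) (A := A)
  have h5 := Finset.card_filter_add_card_filter_not (s := A) (deg G A · = 2)
  omega

/-! ### Chromatic number, maximum average degree and the exceptional cycle -/

theorem HasGood.chromaticNumber_le [Fintype V] (h : HasGood k G Finset.univ ∅) :
    chromaticNumber G ≤ k := by
  obtain ⟨φ, hφ⟩ := h
  refine iInf₂_le (k : ℕ) ⟨SimpleGraph.Coloring.mk φ fun {v w} hvw =>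
    hφ.proper v (Finset.mem_univ _) w (Finset.mem_univ _) hvw, ?_⟩
  rintro v ⟨w, hw⟩
  rcases hφ.good v (Finset.mem_univ _) with ⟨c, hc⟩ | ⟨-, h | h⟩
  · have hc : ∃! w, G.Adj v w ∧ φ w = c := by simpa using hc
    exact ⟨c, hc⟩
  · exact absurd h (Set.notMem_empty v)
  · exact absurd hw (h w (Finset.mem_univ _))

/-- The average degree of an induced subgraph is at most the maximum average degree; the supremum
defining the latter is not a junk value, as a finite graph has finitely many subgraphs. -/
theorem sum_deg_div_card_le_mad [Finite V] {X : Finset V} (hX : X.Nonempty) :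
    (∑ v ∈ X, deg G X v : ℕ) / (X.card : ℝ) ≤ mad G := by
  have := Fintype.ofFinite V
  have hbdd : BddAbove {d : ℝ | ∃ H : G.Subgraph, H.verts.Nonempty ∧ d = avgDegree H} := by
    refine ((Set.finite_range fun H : G.Subgraph => avgDegree H).subset ?_).bddAbove
    rintro d ⟨H, -, rfl⟩
    exact ⟨H, rfl⟩
  refine le_csSup hbdd ⟨(⊤ : G.Subgraph).induce X, by simpa using hX, ?_⟩
  have hsum := ((⊤ : G.Subgraph).induce (X : Set V)).spanningCoe.sum_degrees_eq_twice_card_edges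
  have hedge : (((⊤ : G.Subgraph).induce (X : Set V)).edgeSet.ncard) =
      ((⊤ : G.Subgraph).induce (X : Set V)).spanningCoe.edgeFinset.card := by
    rw [← SimpleGraph.Subgraph.edgeSet_spanningCoe, ← SimpleGraph.coe_edgeFinset,
      Set.ncard_coe_finset]
  have hdeg : ∀ v, ((⊤ : G.Subgraph).induce (X : Set V)).spanningCoe.degree v =
      if v ∈ X then deg G X v else 0 := by
    intro v
    rw [← SimpleGraph.card_neighborFinset_eq_degree]
    split_ifs with hv
    · unfold deg
      congr 1
      ext w
      simp [hv]
    · rw [Finset.card_eq_zero, Finset.eq_empty_iff_forall_notMem]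
      intro w
      simp [hv]
  simp only [hdeg, Finset.sum_ite_mem, Finset.univ_inter] at hsum
  unfold avgDegree
  rw [hedge, hsum]
  simp

/-- A connected graph one of whose components is a cycle of length five is that cycle, and its only
block is the graph itself. -/
theorem IsCycleIn.isC5BlockGraph [Fintype V] (hG : G.Connected) {p : Fin 5 → V}
    (hp : IsCycleIn G Finset.univ p) : IsC5BlockGraph G := by
  have hadj : ∀ i z, G.Adj (p i) z ↔ z = p (i + 1) ∨ z = p (i - 1) :=
    fun i z => hp.adj i z (Finset.mem_univ _)
  have hreach : ∀ a b, G.Walk a b → a ∈ Set.range p → b ∈ Set.range p := by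
    intro a b w
    induction w with
    | nil => exact id
    | cons h _ ih =>
      rintro ⟨i, rfl⟩
      exact ih (((hadj i _).1 h).elim (fun e => ⟨_, e.symm⟩) fun e => ⟨_, e.symm⟩)
  have hsurj : Function.Surjective p := fun b =>
    hreach (p 0) b (hG.preconnected (p 0) b).some ⟨0, rfl⟩
  let e : Fin 5 ≃ V := Equiv.ofBijective p ⟨hp.inj, hsurj⟩
  have hcyc : ∀ i j : Fin 5, G.Adj (p i) (p j) ↔ (SimpleGraph.cycleGraph 5).Adj i j := by
    intro i j
    rw [hadj, hp.inj.eq_iff, hp.inj.eq_iff]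
    revert i j
    decide
  let iso : SimpleGraph.cycleGraph 5 ≃g G := ⟨e, fun {i j} => hcyc i j⟩
  have hns : IsNonseparable (⊤ : G.Subgraph) := by
    refine ⟨⟨SimpleGraph.Subgraph.topIso.connected_iff.2 hG⟩, fun v _ => ?_⟩
    obtain ⟨i, rfl⟩ := hsurj v
    -- the remaining vertices `p (i + j)`, `j ≠ 0`, form a path
    have hmem : ∀ j : Fin 5, j ≠ 0 → p (i + j) ∈ ((⊤ : G.Subgraph).deleteVerts {p i}).verts := by
      intro j hj
      simp only [SimpleGraph.Subgraph.deleteVerts_verts, SimpleGraph.Subgraph.verts_top,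
        Set.mem_sdiff, Set.mem_univ, Set.mem_singleton_iff, true_and]
      exact fun h => hj (by simpa using hp.inj h)
    have hstep : ∀ (j : Fin 5) (h : j ≠ 0) (h' : j + 1 ≠ 0),
        ((⊤ : G.Subgraph).deleteVerts {p i}).coe.Reachable
          ⟨p (i + j), hmem j h⟩ ⟨p (i + (j + 1)), hmem (j + 1) h'⟩ := by
      intro j h h'
      refine SimpleGraph.Adj.reachable ?_
      rw [SimpleGraph.Subgraph.coe_adj, SimpleGraph.Subgraph.deleteVerts_adj]
      refine ⟨trivial, (hmem j h).2, trivial, (hmem _ h').2, ?_⟩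
      rw [SimpleGraph.Subgraph.top_adj, hadj, add_assoc]
      exact Or.inl rfl
    have h12 := hstep 1 (by decide) (by decide)
    have h13 := h12.trans (hstep 2 (by decide) (by decide))
    have h14 := h13.trans (hstep 3 (by decide) (by decide))
    have hall : ∀ w, ((⊤ : G.Subgraph).deleteVerts {p i}).coe.Reachable
        ⟨p (i + 1), hmem 1 (by decide)⟩ w := by
      rintro ⟨w, hw⟩
      obtain ⟨l, rfl⟩ := hsurj w
      obtain ⟨j, rfl⟩ : ∃ j, l = i + j := ⟨l - i, by abel⟩
      fin_cases j
      · exact absurd (congrArg p (add_zero i)) hw.2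
      · exact SimpleGraph.Reachable.refl _
      · exact h12
      · exact h13
      · exact h14
    exact fun a b => (hall a).symm.trans (hall b)
  refine ⟨e.symm.nontrivial, hG, fun B hB => ?_⟩
  obtain rfl : B = ⊤ := le_antisymm le_top (hB.2 hns le_top)
  exact ⟨(iso.trans SimpleGraph.Subgraph.topIso.symm).symm⟩

end PCF

theorem mainTheorem4 {V : Type*} [Finite V] (G : SimpleGraph V) (hG : G.Connected) :
    (PCF.mad G < 8 / 3 → PCF.chromaticNumber G ≤ 6) ∧
    (PCF.mad G < 5 / 2 → PCF.chromaticNumber G ≤ 5) ∧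
    (PCF.mad G < 24 / 11 → ¬ PCF.IsC5BlockGraph G → PCF.chromaticNumber G ≤ 4) := by
  have := Fintype.ofFinite V
  -- clearing denominators in a bound for the maximum average degree
  have hsparse : ∀ a b : ℕ, 0 < b → PCF.mad G < (a : ℝ) / b → ∀ X : Finset V, X.Nonempty →
      b * ∑ v ∈ X, PCF.deg G X v < a * X.card := by
    intro a b hb hm X hX
    have h1 := (PCF.sum_deg_div_card_le_mad (G := G) hX).trans_lt hm
    have hX0 : (0 : ℝ) < X.card := by exact_mod_cast hX.card_pos
    have hb0 : (0 : ℝ) < b := by exact_mod_cast hb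
    rw [div_lt_div_iff₀ hX0 hb0] at h1
    rw [mul_comm]
    exact_mod_cast h1
  refine ⟨fun h => ?_, fun h => ?_, fun h hC => ?_⟩
  · exact (PCF.hasGood_six (hsparse 8 3 (by norm_num) (by exact_mod_cast h)) _).chromaticNumber_le
  · exact (PCF.hasGood_five (hsparse 5 2 (by norm_num) (by exact_mod_cast h)) _).chromaticNumber_le
  · exact (PCF.hasGood_four (hsparse 24 11 (by norm_num) (by exact_mod_cast h)) _ _
      fun p hp => absurd (hp.isC5BlockGraph hG) hC).chromaticNumber_le
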